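/- **Theorem.** Let $F$ be a non-Archimedean local field of characteristic $0$ with normalized absolute value $|\cdot|$, and fix a nontrivial continuous additive character $\kappa:F\to\{z\in\mathbb C:|z|=1\}$. Let $G$ be an $F$-analytic group acting $F$-analytically on a Hausdorff $F$-analytic manifold $X$, let $E$ be a $G$-equivariant locally constant sheaf of finite-dimensional complex vector spaces on $X$, and let $D_X$ be the sheaf of locally constant measures on $X$ (those that in local charts are constant multiples of the Haar measure of $F^n$). Let $\mathcal S(X,D_X\otimes E^*)$ be the space of compactly supported sections of $D_X\otimes E^*$ and $\mathcal G(X,E):=\mathcal S(X,D_X\otimes E^*)^*$ its full linear dual, the space of generalized sections of $E$. For an open set $U\subset F^n$ and a linear functional $\xi$ on the space $\mathcal S(U)$ of locally constant compactly supported functions $U\to\mathbb C$, call $\xi$ smooth at $(x_0,v_0)\in T^*U=U\times (F^n)^*$ if there are open neighborhoods $A\subset U$ of $x_0$ and $B\subset (F^n)^*$ of $v_0$ such that for every $\phi\in\mathcal S(A)$ there is $N_\phi>0$ such that for every $\lambda\in F$ with $|\lambda|>N_\phi$ the Fourier transform $\widehat{\phi\xi}(w)=\langle\xi,\ \phi\cdot\kappa(\langle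 w,\cdot\rangle)\rangle$ vanishes for all $w\in\lambda B$. The wave front set $WF(\xi)\subset T^*U$ is the set of points where $\xi$ is not smooth. For $\xi\in\mathcal G(X,E)$ the wave front set $WF(\xi)\subset T^*X$ is defined through charts: it is the union, over all analytic charts $e$ of $X$ and all sections $\ell$ of $E^*$ on the domain of $e$, of the pullbacks under $e$ of the wave front sets of the distributions $\phi\mapsto\xi\big((\phi\circ e)\, e^*(dx)\otimes\ell\big)$ on the image of $e$. Let $\mathfrak g$ be the Lie algebra of $G$; for $\alpha\in\mathfrak g$ and $x\in X$ let $\alpha(x)\in T_xX$ be the value at $x$ of the vector field defined by $\alpha$, and let $\mathfrak g x=\{\alpha(x):\alpha\in\mathfrak g\}\subset T_xX$. Then for every $G$-invariant generalized section $\xi\in\mathcal G(X,E)^G$, $$WF(\xi)\subset\{(x,v)\in T^*X:\ v(\mathfrak g x)=0\}.$$ -/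

import Mathlib

open scoped Manifold ContDiff Topology Pointwise
open MeasureTheory TopologicalSpace

noncomputable section

namespace WaveFront

universe u w

/-! ### The normalized absolute value and additive characters of a local field -/

section Field

variable {F : Type*} [NontriviallyNormedField F] [LocallyCompactSpace F]

open scoped Classical in
/-- The normalized absolute value of a local field: multiplication by `a` multiplies Haar measure
on `F` by `modulus a`. -/
def modulus (a : F) : ℝ :=
  if h : a = 0 then 0 else (distribHaarChar F (Units.mk0 a h) : ℝ)

theorem modulus_mul (a b : F) : modulus (a * b) = modulus a * modulus b := by
  by_cases ha : a = 0
  · simp [modulus, ha]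
  by_cases hb : b = 0
  · simp [modulus, hb]
  · have : Units.mk0 (a * b) (mul_ne_zero ha hb) = Units.mk0 a ha * Units.mk0 b hb := by
      ext; simp
    simp only [modulus, ha, hb, mul_ne_zero ha hb, dite_false, this, map_mul, NNReal.coe_mul]

theorem modulus_pos {a : F} (ha : a ≠ 0) : 0 < modulus a := by
  simp only [modulus, ha, dite_false]
  exact_mod_cast distribHaarChar_pos

theorem modulus_eq_one_of_norm {a : F} (h : ‖a‖ = 1) : modulus a = 1 := by
  have ha : a ≠ 0 := by rintro rfl; simp at h
  simp only [modulus, ha, dite_false]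
  borelize F
  have : ProperSpace F := ProperSpace.of_locallyCompactSpace F
  have key : distribHaarChar F (Units.mk0 a ha) = 1 := by
    refine distribHaarChar_eq_of_measure_smul_eq_mul (μ := Measure.addHaar)
      (s := Metric.closedBall (0 : F) 1) ?_ ?_ ?_
    · exact (Metric.measure_closedBall_pos _ _ one_pos).ne'
    · exact (isCompact_closedBall (0 : F) 1).measure_lt_top.ne
    · have : (Units.mk0 a ha) • Metric.closedBall (0 : F) 1 = Metric.closedBall (0 : F) 1 := by
        ext y
        simp only [Set.mem_smul_set_iff_inv_smul_mem, mem_closedBall_zero_iff]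
        rw [Units.smul_def, smul_eq_mul, norm_mul]
        simp [h]
      rw [this]; simp
  simp [key]

theorem modulus_eventuallyEq [IsUltrametricDist F] {Y : Type*} [TopologicalSpace Y] {f : Y → F}
    {y : Y} (hf : ContinuousAt f y) (h0 : f y ≠ 0) :
    ∀ᶠ z in 𝓝 y, modulus (f z) = modulus (f y) := by
  have h1 : ∀ᶠ z in 𝓝 y, ‖f z - f y‖ < ‖f y‖ := by
    have : Filter.Tendsto (fun z => ‖f z - f y‖) (𝓝 y) (𝓝 0) := by
      have := (hf.sub (continuousAt_const (y := f y))).norm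
      simpa [ContinuousAt] using this
    exact this.eventually_lt_const (norm_pos_iff.2 h0)
  filter_upwards [h1] with z hz
  have hn : ‖f z‖ = ‖f y‖ := by
    have h2 := IsUltrametricDist.norm_add_eq_max_of_norm_ne_norm (x := f z - f y) (y := f y) hz.ne
    rw [sub_add_cancel, max_eq_right hz.le] at h2
    exact h2
  have h3 : modulus (f z / f y) = 1 := by
    apply modulus_eq_one_of_norm
    rw [norm_div, hn, div_self (norm_ne_zero_iff.2 h0)]
  calc modulus (f z) = modulus (f z / f y * f y) := by rw [div_mul_cancel₀ _ h0]
    _ = modulus (f y) := by rw [modulus_mul, h3, one_mul]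

/-- A unit complex number all of whose powers stay within `1 / 2` of `1` equals `1`. -/
theorem circle_eq_one_of_pow_near (z : Circle) (h : ∀ k : ℕ, ‖((z ^ k : Circle) : ℂ) - 1‖ ≤ 1 / 2) :
    z = 1 := by
  have step : ∀ k : ℕ, (3 / 2 : ℝ) ^ k * ‖(z : ℂ) - 1‖ ≤ ‖((z ^ (2 ^ k) : Circle) : ℂ) - 1‖ := by
    intro k
    induction k with
    | zero => simp
    | succ k ih =>
      set t : ℂ := ((z ^ (2 ^ k) : Circle) : ℂ) with ht
      have e1 : ((z ^ (2 ^ (k + 1)) : Circle) : ℂ) - 1 = (t - 1) * (t + 1) := by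
        rw [ht, pow_succ 2 k, pow_mul]; push_cast; ring
      have e2 : (3 / 2 : ℝ) ≤ ‖t + 1‖ := by
        have h2 : ‖(2 : ℂ)‖ ≤ ‖t + 1‖ + ‖t - 1‖ := by
          have := norm_sub_le (t + 1) (t - 1)
          have e : (t + 1) - (t - 1) = 2 := by ring
          rwa [e] at this
        have h3 := h (2 ^ k)
        rw [← ht] at h3
        norm_num at h2
        linarith
      rw [e1, norm_mul, pow_succ]
      nlinarith [norm_nonneg (t - 1), norm_nonneg ((z : ℂ) - 1)]
  have h0 : ‖(z : ℂ) - 1‖ = 0 := by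
    by_contra hne
    have hpos : 0 < ‖(z : ℂ) - 1‖ := lt_of_le_of_ne (norm_nonneg _) (Ne.symm hne)
    obtain ⟨k, hk⟩ := pow_unbounded_of_one_lt (1 / ‖(z : ℂ) - 1‖) (by norm_num : (1 : ℝ) < 3 / 2)
    have h4 := (step k).trans (h _)
    rw [div_lt_iff₀ hpos] at hk
    linarith
  have h1 : (z : ℂ) = 1 := sub_eq_zero.1 (norm_eq_zero.1 h0)
  exact_mod_cast Circle.ext (by simpa using h1)

/-- A continuous additive character of a non-Archimedean field is locally constant. -/
theorem addChar_isLocallyConstant {F : Type*} [NontriviallyNormedField F]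
    [IsUltrametricDist F] {κ : AddChar F Circle} (hκ : Continuous κ) : IsLocallyConstant κ := by
  have hc : Continuous (fun a : F => ‖((κ a : Circle) : ℂ) - 1‖) := by fun_prop
  have h0 : ∀ᶠ a in 𝓝 (0 : F), ‖((κ a : Circle) : ℂ) - 1‖ < 1 / 2 := by
    apply hc.continuousAt.eventually_lt_const
    simp
  obtain ⟨r, hr, hball⟩ := Metric.eventually_nhds_iff_ball.1 h0
  have hone : ∀ a ∈ Metric.ball (0 : F) r, κ a = 1 := by
    intro a ha
    apply circle_eq_one_of_pow_near
    intro k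
    have hk : k • a ∈ Metric.ball (0 : F) r := by
      rw [mem_ball_zero_iff] at ha ⊢
      refine lt_of_le_of_lt ?_ ha
      rw [nsmul_eq_mul, norm_mul]
      exact mul_le_of_le_one_left (norm_nonneg _) (IsUltrametricDist.norm_natCast_le_one F k)
    rw [← AddChar.map_nsmul_eq_pow]
    exact (hball _ hk).le
  rw [IsLocallyConstant.iff_eventually_eq]
  intro a
  filter_upwards [Metric.ball_mem_nhds a hr] with b hb
  have h1 : κ (b - a) = 1 := hone _ (by rwa [mem_ball_zero_iff, ← dist_eq_norm])
  calc κ b = κ ((b - a) + a) := by rw [sub_add_cancel]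
    _ = κ a := by rw [AddChar.map_add_eq_mul, h1, one_mul]

end Field

/-! ### Distributions on open subsets of `F ^ n` and their wave front sets -/

/-- Schwartz functions on a totally disconnected locally compact space: locally constant complex
functions with compact support. -/
def Schwartz (Y : Type*) [TopologicalSpace Y] : Submodule ℂ (Y → ℂ) where
  carrier := {f | IsLocallyConstant f ∧ HasCompactSupport f}
  add_mem' hf hg := ⟨hf.1.add hg.1, hf.2.add hg.2⟩
  zero_mem' := ⟨IsLocallyConstant.const 0, HasCompactSupport.zero⟩
  smul_mem' c _ hf := ⟨hf.1.comp (fun z => c * z), hf.2.smul_left (f := fun _ : Y => c)⟩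

/-- Distributions: arbitrary linear functionals on Schwartz functions. -/
abbrev Distribution (Y : Type*) [TopologicalSpace Y] : Type _ := Module.Dual ℂ (Schwartz Y)

section Euclidean

variable {F : Type*} [NontriviallyNormedField F] [IsUltrametricDist F] [LocallyCompactSpace F]
  {κ : AddChar F Circle} (hκ : Continuous κ) {n : ℕ} {U : Opens (Fin n → F)}

/-- The Schwartz function `x ↦ φ x * κ (w x)` on `U`. -/
def modulate (φ : Schwartz U) (w : (Fin n → F) →L[F] F) : Schwartz U :=
  ⟨fun x => φ.1 x * ((κ (w x) : Circle) : ℂ), by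
    have h1 : IsLocallyConstant (fun x : U => ((κ (w x) : Circle) : ℂ)) :=
      ((addChar_isLocallyConstant hκ).comp_continuous
        (w.continuous.comp continuous_subtype_val)).comp (fun z : Circle => (z : ℂ))
    exact ⟨φ.2.1.mul h1, φ.2.2.mul_right⟩⟩

/-- The Fourier transform of the compactly supported distribution `φ ξ`; it is the function
`w ↦ ⟨φ ξ, κ (w ·)⟩` on the dual space of `F ^ n`. -/
def fourierCutoff (ξ : Distribution U) (φ : Schwartz U) (w : (Fin n → F) →L[F] F) : ℂ :=
  ξ (modulate hκ φ w)

/-- `ξ` is smooth at `(x₀, v₀)`. The functions `φ` are the elements of `𝒮(A)`, extended by zero. -/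
def IsSmoothAt (ξ : Distribution U) (x₀ : U) (v₀ : (Fin n → F) →L[F] F) : Prop :=
  ∃ A : Set U, IsOpen A ∧ x₀ ∈ A ∧ ∃ B : Set ((Fin n → F) →L[F] F), IsOpen B ∧ v₀ ∈ B ∧
    ∀ φ : Schwartz U, Function.support φ.1 ⊆ A →
      ∃ N : ℝ, 0 < N ∧ ∀ lam : F, N < ‖lam‖ → ∀ w ∈ B, fourierCutoff hκ ξ φ (lam • w) = 0

/-- The wave front set, as a subset of `T^*U = U × (F ^ n)^*`, of a distribution on an open
subset `U` of `F ^ n`. -/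
def waveFrontSetOpen (ξ : Distribution U) : Set (U × ((Fin n → F) →L[F] F)) :=
  {p | ¬ IsSmoothAt hκ ξ p.1 p.2}

end Euclidean

/-! ### Densities -/

section Density

variable (F : Type*) [NontriviallyNormedField F] [LocallyCompactSpace F] (n : ℕ)

/-- The complex line of (complex multiples of) Haar measures on an `n`-dimensional space `T`. Such a
measure `μ` is encoded by the function on linear maps `L : F ^ n → T` whose value is the
measure of `L (O ^ n)`, `O` being the ring of integers of `F`. -/
def Density (T : Type*) [AddCommGroup T] [Module F T] [TopologicalSpace T] :
    Submodule ℂ (((Fin n → F) →L[F] T) → ℂ) where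
  carrier := {μ | ∀ (L : (Fin n → F) →L[F] T) (A : (Fin n → F) →L[F] (Fin n → F)),
    μ (L.comp A) = (modulus A.det : ℂ) * μ L}
  add_mem' {μ μ'} h h' L A := by simp only [Pi.add_apply, h L A, h' L A]; ring
  zero_mem' L A := by simp
  smul_mem' c μ h L A := by simp only [Pi.smul_apply, h L A, smul_eq_mul]; ring

theorem det_comp' {F : Type*} [NontriviallyNormedField F] {n : ℕ} (A B : (Fin n → F) →L[F] (Fin n → F)) : (A.comp B).det = A.det * B.det := by
  simp only [ContinuousLinearMap.det]
  exact LinearMap.det_comp _ _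

/-- The standard Haar measure on `F ^ n`. -/
def stdDensity : Density F n (Fin n → F) :=
  ⟨fun L => (modulus L.det : ℂ), fun L A => by
    simp only [det_comp', modulus_mul]; push_cast; ring⟩

variable {F n}

/-- Pullback of densities along a linear map between `n`-dimensional spaces. -/
def Density.pullback {T T' : Type*} [AddCommGroup T] [Module F T] [TopologicalSpace T]
    [AddCommGroup T'] [Module F T'] [TopologicalSpace T'] (D : T →L[F] T') :
    Density F n T' →ₗ[ℂ] Density F n T where
  toFun μ := ⟨fun L => μ.1 (D.comp L), fun L A => by
    exact μ.2 (D.comp L) A⟩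
  map_add' _ _ := rfl
  map_smul' _ _ := rfl

end Density

/-! ### Locally constant sheaves -/

/-- A locally constant sheaf of finite dimensional complex vector spaces, given by its étalé
space: the stalks with a topology on their disjoint union, such that near every point the stalks are
identified linearly with a fixed one in such a way that the total space becomes a product with a
discrete space, that is, every constant local section is an open embedding. -/
structure LocallyConstantSheaf (X : Type u) [TopologicalSpace X] where
  Stalk : X → Type w
  [addCommGroup : ∀ x, AddCommGroup (Stalk x)]
  [module : ∀ x, Module ℂ (Stalk x)]
  [finiteDimensional : ∀ x, FiniteDimensional ℂ (Stalk x)]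
  topology : TopologicalSpace (Σ x, Stalk x)
  locally_constant : ∀ x₀ : X, ∃ U : Set X, IsOpen U ∧ x₀ ∈ U ∧
    ∃ τ : ∀ x : U, Stalk x₀ ≃ₗ[ℂ] Stalk x, ∀ a : Stalk x₀,
      @Topology.IsOpenEmbedding U (Σ x, Stalk x) _ topology (fun x => ⟨x, τ x a⟩)

namespace LocallyConstantSheaf

attribute [instance] addCommGroup module finiteDimensional

variable {X : Type u} [TopologicalSpace X] (E : LocallyConstantSheaf.{u, w} X)

/-- The étalé space. -/
def Total : Type _ := Σ x, E.Stalk x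

instance : TopologicalSpace E.Total := E.topology

/-- The point `a ∈ E_x` of the étalé space. -/
def pt (x : X) (a : E.Stalk x) : E.Total := ⟨x, a⟩

/-- Near `x`, the family `s` is a section of `E`. (A family that is continuous at `x`
as a map to the étalé space coincides near `x` with a constant local section.) -/
def IsSectionAt (s : ∀ x, E.Stalk x) (x : X) : Prop :=
  ContinuousAt (fun y => E.pt y (s y)) x

/-- `ℓ` is a section over `S` of the dual locally constant sheaf `E^*`. -/
def IsDualSectionOn (ℓ : ∀ x, Module.Dual ℂ (E.Stalk x)) (S : Set X) : Prop :=
  ∀ x ∈ S, ∀ s : ∀ x, E.Stalk x, E.IsSectionAt s x → ∀ᶠ y in 𝓝 x, ℓ y (s y) = ℓ x (s x)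

/-- A `G`-equivariant structure: an action of `G` on the étalé space, continuous
as a map `G × E → E`, linear on stalks and covering the action on `X`. -/
structure Equivariant (G : Type*) [Group G] [TopologicalSpace G] [MulAction G X] where
  act : ∀ (g : G) (x : X), E.Stalk x →ₗ[ℂ] E.Stalk (g • x)
  act_one : ∀ (x : X) (a : E.Stalk x), E.pt ((1 : G) • x) (act 1 x a) = E.pt x a
  act_mul : ∀ (g h : G) (x : X) (a : E.Stalk x),
    E.pt ((g * h) • x) (act (g * h) x a) = E.pt (g • h • x) (act g (h • x) (act h x a))
  continuous_act : Continuous (fun p : G × E.Total => E.pt (p.1 • p.2.1) (act p.1 p.2.1 p.2.2))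

variable {E} in
/-- The translate by `g` of a section of `E` near `x` is a section of `E` near `g • x`. -/
theorem Equivariant.exists_translate {G : Type*} [Group G] [TopologicalSpace G] [MulAction G X]
    (τ : E.Equivariant G) (g : G) {s : ∀ x, E.Stalk x} {x : X} (hs : E.IsSectionAt s x)
    (hg : Continuous (fun y : X => g⁻¹ • y)) :
    ∃ s' : ∀ x, E.Stalk x, E.IsSectionAt s' (g • x) ∧ ∀ y, s' (g • y) = τ.act g y (s y) := by
  have hpt : ∀ (z z' : X) (h : z' = z) (a : E.Stalk z'), E.pt z (h ▸ a) = E.pt z' a := by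
    rintro z _ rfl a; rfl
  set s' : ∀ z, E.Stalk z := fun z => smul_inv_smul g z ▸ τ.act g (g⁻¹ • z) (s (g⁻¹ • z)) with hs'
  have h1 : ∀ z, E.pt z (s' z) = E.pt (g • g⁻¹ • z) (τ.act g (g⁻¹ • z) (s (g⁻¹ • z))) :=
    fun z => hpt _ _ _ _
  refine ⟨s', ?_, fun y => ?_⟩
  · have h2 : (fun z => E.pt z (s' z)) = (fun p : G × E.Total =>
        E.pt (p.1 • p.2.1) (τ.act p.1 p.2.1 p.2.2)) ∘ (fun t => (g, t)) ∘
          (fun y => E.pt y (s y)) ∘ (fun z => g⁻¹ • z) := by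
      funext z; exact h1 z
    unfold IsSectionAt
    rw [h2]
    refine τ.continuous_act.continuousAt.comp ((by fun_prop : Continuous
      (fun t : E.Total => (g, t))).continuousAt.comp ?_)
    refine ContinuousAt.comp ?_ hg.continuousAt
    rw [inv_smul_smul]
    exact hs
  · have h3 : E.pt (g • y) (s' (g • y)) = E.pt (g • y) (τ.act g y (s y)) := by
      rw [h1]
      have : ∀ y', y' = y → E.pt (g • y') (τ.act g y' (s y')) =
          E.pt (g • y) (τ.act g y (s y)) := by rintro _ rfl; rfl
      exact this _ (inv_smul_smul g y)
    exact eq_of_heq (Sigma.mk.inj h3).2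

end LocallyConstantSheaf

/-! ### Generalized sections on an analytic manifold -/

section Manifold

variable {F : Type*} [NontriviallyNormedField F] [LocallyCompactSpace F]
  {n : ℕ} {X : Type u} [TopologicalSpace X] [ChartedSpace (Fin n → F) X]

variable (F n) in
/-- The stalk at `x` of the sheaf `D_X` of locally constant measures: Haar measures
on the tangent space `T_x X`. -/
abbrev DensityAt (x : X) : Type _ := Density F n (TangentSpace 𝓘(F, Fin n → F) x)

/-- The pullback `h^*(dx)` to `T_y X` of the Haar measure of `F ^ n`. -/
def chartDensity (h : X → (Fin n → F)) (y : X) : DensityAt F n y :=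
  Density.pullback (T' := Fin n → F) (mfderiv 𝓘(F, Fin n → F) 𝓘(F, Fin n → F) h y)
    (stdDensity F n)

/-- Near `x`, `μ` is a section of `D_X`, i.e. a constant multiple of the Haar measure of
`F ^ n` in every chart around `x`. -/
def IsDensitySectionAt (μ : ∀ x : X, DensityAt F n x) (x : X) : Prop :=
  ∀ e ∈ IsManifold.maximalAtlas 𝓘(F, Fin n → F) ω X, x ∈ e.source →
    ∃ c : ℂ, ∀ᶠ y in 𝓝 x, μ y = c • chartDensity e y

variable (F n) in
/-- The space `𝒮(X, D_X ⊗ E^*)` of compactly supported sections of `D_X ⊗ E^* = Hom(E, D_X)`: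
families of linear maps from the stalks of `E` to those of `D_X` that carry local
sections of `E` to local sections of `D_X` and vanish outside a compact set. -/
def DualTestSections (E : LocallyConstantSheaf.{u, w} X) :
    Submodule ℂ (∀ x : X, E.Stalk x →ₗ[ℂ] DensityAt F n x) where
  carrier := {f | (∀ x : X, ∀ s : ∀ x, E.Stalk x, E.IsSectionAt s x →
      IsDensitySectionAt (fun y => f y (s y)) x) ∧ ∃ K : Set X, IsCompact K ∧ ∀ x ∉ K, f x = 0}
  add_mem' := by
    rintro f g ⟨hf, K, hK, hfK⟩ ⟨hg, K', hK', hgK⟩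
    refine ⟨fun x s hs e he hx => ?_, K ∪ K', hK.union hK', fun x hx => ?_⟩
    · obtain ⟨c, hc⟩ := hf x s hs e he hx
      obtain ⟨c', hc'⟩ := hg x s hs e he hx
      refine ⟨c + c', ?_⟩
      filter_upwards [hc, hc'] with y h h'
      simp only [Pi.add_apply, LinearMap.add_apply, h, h', add_smul]
    · simp only [Set.mem_union, not_or] at hx
      simp [hfK x hx.1, hgK x hx.2]
  zero_mem' := ⟨fun x s hs e he hx => ⟨0, by simp⟩, ∅, isCompact_empty, fun x _ => rfl⟩
  smul_mem' := by
    rintro a f ⟨hf, K, hK, hfK⟩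
    refine ⟨fun x s hs e he hx => ?_, K, hK, fun x hx => ?_⟩
    · obtain ⟨c, hc⟩ := hf x s hs e he hx
      refine ⟨a * c, ?_⟩
      filter_upwards [hc] with y h
      simp only [Pi.smul_apply, LinearMap.smul_apply, h, mul_smul]
    · simp [hfK x hx]

variable (F n) in
/-- Generalized sections of `E`: the space `𝒢(X, E) = 𝒮^*(X, D_X ⊗ E^*)`. -/
abbrev GeneralizedSection (E : LocallyConstantSheaf.{u, w} X) : Type _ :=
  Module.Dual ℂ (DualTestSections F n E)

theorem bijective_mfderiv_of_mem_maximalAtlas {F : Type*} [NontriviallyNormedField F]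
    {n : ℕ} {X : Type u} [TopologicalSpace X] [ChartedSpace (Fin n → F) X]
    [IsManifold 𝓘(F, Fin n → F) ω X]
    {e : OpenPartialHomeomorph X (Fin n → F)}
    (he : e ∈ IsManifold.maximalAtlas 𝓘(F, Fin n → F) ω X) {x : X} (hx : x ∈ e.source) :
    Function.Bijective (mfderiv 𝓘(F, Fin n → F) 𝓘(F, Fin n → F) e x) := by
  have hmd : e.MDifferentiable 𝓘(F, Fin n → F) 𝓘(F, Fin n → F) :=
    ⟨(contMDiffOn_of_mem_maximalAtlas he).mdifferentiableOn (by simp),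
      (contMDiffOn_symm_of_mem_maximalAtlas he).mdifferentiableOn (by simp)⟩
  exact hmd.mfderiv_bijective hx

/-- Two systems of local analytic coordinates at `x` have proportional densities near `x`. -/
theorem chartDensity_eventuallyEq [IsUltrametricDist F] [IsManifold 𝓘(F, Fin n → F) ω X]
    {h k : X → (Fin n → F)} {x : X}
    (hh : ContMDiffAt 𝓘(F, Fin n → F) 𝓘(F, Fin n → F) ω h x)
    (hk : ContMDiffAt 𝓘(F, Fin n → F) 𝓘(F, Fin n → F) ω k x)
    (hk0 : Function.Injective (mfderiv 𝓘(F, Fin n → F) 𝓘(F, Fin n → F) k x))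
    (hh0 : Function.Injective (mfderiv 𝓘(F, Fin n → F) 𝓘(F, Fin n → F) h x)) :
    ∃ c : ℂ, ∀ᶠ y in 𝓝 x, chartDensity h y = c • chartDensity k y := by
  set p := chartAt (Fin n → F) x with hp
  have hpx : x ∈ p.source := mem_chart_source _ x
  have hpm : p ∈ IsManifold.maximalAtlas 𝓘(F, Fin n → F) ω X :=
    IsManifold.chart_mem_maximalAtlas x
  have key : ∀ f : X → (Fin n → F), ContMDiffAt 𝓘(F, Fin n → F) 𝓘(F, Fin n → F) ω f x →
      Function.Injective (mfderiv 𝓘(F, Fin n → F) 𝓘(F, Fin n → F) f x) →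
      ∃ c : ℝ, c ≠ 0 ∧ ∀ᶠ y in 𝓝 x, chartDensity f y = (c : ℂ) • chartDensity p y := by
    intro f hf hinj
    set D : X → (Fin n → F) →L[F] (Fin n → F) := fun y => fderiv F (f ∘ p.symm) (p y) with hD
    have hsymm : ContMDiffAt 𝓘(F, Fin n → F) 𝓘(F, Fin n → F) ω p.symm (p x) :=
      contMDiffAt_symm_of_mem_maximalAtlas hpm (p.map_source hpx)
    have hfp : ContDiffAt F ω (f ∘ p.symm) (p x) := by
      rw [← contMDiffAt_iff_contDiffAt]
      refine ContMDiffAt.comp (p x) ?_ hsymm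
      rwa [p.left_inv hpx]
    have hDc : ContinuousAt D x :=
      (hfp.continuousAt_fderiv (by simp)).comp (p.continuousAt hpx)
    have hfact : ∀ᶠ y in 𝓝 x, mfderiv 𝓘(F, Fin n → F) 𝓘(F, Fin n → F) f y =
        (D y).comp (mfderiv 𝓘(F, Fin n → F) 𝓘(F, Fin n → F) p y :
          (Fin n → F) →L[F] (Fin n → F)) := by
      have h1 : ∀ᶠ z in 𝓝 (p x), ContDiffAt F 1 (f ∘ p.symm) z :=
        (hfp.of_le (by simp)).eventually (by simp)
      filter_upwards [(p.continuousAt hpx).eventually h1, p.open_source.mem_nhds hpx] with y hy hys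
      have e1 : f =ᶠ[𝓝 y] (f ∘ p.symm) ∘ p := by
        filter_upwards [p.open_source.mem_nhds hys] with z hz
        simp [p.left_inv hz]
      rw [e1.mfderiv_eq]
      have d1 : MDifferentiableAt 𝓘(F, Fin n → F) 𝓘(F, Fin n → F) (f ∘ p.symm) (p y) :=
        (hy.differentiableAt (by simp)).mdifferentiableAt
      have d2 : MDifferentiableAt 𝓘(F, Fin n → F) 𝓘(F, Fin n → F) p y :=
        (contMDiffAt_of_mem_maximalAtlas hpm hys).mdifferentiableAt (by simp)
      rw [mfderiv_comp y d1 d2, mfderiv_eq_fderiv]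
      rfl
    have hbij := bijective_mfderiv_of_mem_maximalAtlas hpm hpx
    have hdet : (D x).det ≠ 0 := by
      have hDinj : Function.Injective (D x) := by
        intro a b hab
        obtain ⟨a', rfl⟩ := hbij.2 a
        obtain ⟨b', rfl⟩ := hbij.2 b
        have hx1 := hfact.self_of_nhds
        have : a' = b' := by
          apply hinj
          rw [hx1]
          exact hab
        rw [this]
      have := LinearMap.isUnit_iff_ker_eq_bot (D x : (Fin n → F) →ₗ[F] (Fin n → F)) |>.2
        (LinearMap.ker_eq_bot.2 hDinj)
      exact (this.map LinearMap.det).ne_zero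
    have : ProperSpace F := ProperSpace.of_locallyCompactSpace F
    have hdetc : ContinuousAt (fun y => (D y).det) x :=
      ContinuousLinearMap.continuous_det.continuousAt.comp hDc
    refine ⟨modulus (D x).det, (modulus_pos hdet).ne', ?_⟩
    filter_upwards [hfact, modulus_eventuallyEq hdetc hdet] with y hy hy'
    apply Subtype.ext
    funext L
    have e2 : ContinuousLinearMap.comp (mfderiv 𝓘(F, Fin n → F) 𝓘(F, Fin n → F) f y) L =
        (D y).comp (ContinuousLinearMap.comp
          (mfderiv 𝓘(F, Fin n → F) 𝓘(F, Fin n → F) p y) L : (Fin n → F) →L[F] (Fin n → F)) := by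
      rw [hy]; rfl
    change ((modulus (ContinuousLinearMap.det (M := Fin n → F) (R := F)
        (ContinuousLinearMap.comp (mfderiv 𝓘(F, Fin n → F) 𝓘(F, Fin n → F) f y) L)) : ℝ) : ℂ) =
      (modulus (D x).det : ℂ) * ((modulus (ContinuousLinearMap.det (M := Fin n → F) (R := F)
        (ContinuousLinearMap.comp (mfderiv 𝓘(F, Fin n → F) 𝓘(F, Fin n → F) p y) L)) : ℝ) : ℂ)
    have e3 := det_comp' (D y) (ContinuousLinearMap.comp
          (mfderiv 𝓘(F, Fin n → F) 𝓘(F, Fin n → F) p y) L : (Fin n → F) →L[F] (Fin n → F))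
    rw [← hy', ← Complex.ofReal_mul, ← modulus_mul]
    refine congrArg (fun t : F => ((modulus t : ℝ) : ℂ)) (Eq.trans ?_ e3)
    exact congrArg (fun M => ContinuousLinearMap.det (M := Fin n → F) (R := F) M) e2
  obtain ⟨a, -, ha⟩ := key h hh hh0
  obtain ⟨b, hb0, hb⟩ := key k hk hk0
  refine ⟨a * (b : ℂ)⁻¹, ?_⟩
  filter_upwards [ha, hb] with y hy hy'
  rw [hy, hy', smul_smul, mul_assoc, inv_mul_cancel₀ (by exact_mod_cast hb0), mul_one]

section TestSection

variable [IsUltrametricDist F] [IsManifold 𝓘(F, Fin n → F) ω X] [T2Space X]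
  (E : LocallyConstantSheaf.{u, w} X)

/-- The image of a chart, as an open subset of `F ^ n`. -/
def chartTarget (e : OpenPartialHomeomorph X (Fin n → F)) : Opens (Fin n → F) :=
  ⟨e.target, e.open_target⟩

open scoped Classical in
/-- For a chart `e`, a section `ℓ` of `E^*` on its domain and a Schwartz function `φ` on
its image, the test section `(φ ∘ e) · e^*(dx) ⊗ ℓ`, extended by zero to `X`. -/
def testSection {e : OpenPartialHomeomorph X (Fin n → F)}
    (he : e ∈ IsManifold.maximalAtlas 𝓘(F, Fin n → F) ω X)
    {ℓ : ∀ x, Module.Dual ℂ (E.Stalk x)} (hℓ : E.IsDualSectionOn ℓ e.source) :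
    Schwartz (chartTarget e) →ₗ[ℂ] DualTestSections F n E where
  toFun φ := ⟨fun x => if hx : x ∈ e.source then
      φ.1 ⟨e x, e.map_source hx⟩ • (ℓ x).smulRight (chartDensity e x) else 0, by
    have hK : IsCompact ((fun u : chartTarget e => e.symm u.1) '' tsupport φ.1) := by
      refine φ.2.2.isCompact.image ?_
      exact e.continuousOn_symm.domRestrict
    have hzero : ∀ x ∉ (fun u : chartTarget e => e.symm u.1) '' tsupport φ.1,
        (if hx : x ∈ e.source then
          φ.1 ⟨e x, e.map_source hx⟩ • (ℓ x).smulRight (chartDensity e x) else 0) = 0 := by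
      intro x hxK
      split_ifs with hx
      · have : φ.1 ⟨e x, e.map_source hx⟩ = 0 := by
          by_contra h0
          exact hxK ⟨⟨e x, e.map_source hx⟩, subset_tsupport _ h0, e.left_inv hx⟩
        rw [this, zero_smul]
      · rfl
    refine ⟨fun x s hs e' he' hx' => ?_, _, hK, hzero⟩
    by_cases hx : x ∈ e.source
    · obtain ⟨c, hc⟩ := chartDensity_eventuallyEq (contMDiffAt_of_mem_maximalAtlas he hx)
        (contMDiffAt_of_mem_maximalAtlas he' hx')
        (bijective_mfderiv_of_mem_maximalAtlas he' hx').1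
        (bijective_mfderiv_of_mem_maximalAtlas he hx).1
      refine ⟨φ.1 ⟨e x, e.map_source hx⟩ * (ℓ x (s x) * c), ?_⟩
      have hφ : ∀ᶠ y in 𝓝 x, ∀ hy : y ∈ e.source,
          φ.1 ⟨e y, e.map_source hy⟩ = φ.1 ⟨e x, e.map_source hx⟩ := by
        have h1 := (IsLocallyConstant.iff_eventually_eq φ.1).1 φ.2.1 ⟨e x, e.map_source hx⟩
        replace h1 := (Filter.eventually_comap).1
          ((nhds_induced (Subtype.val : chartTarget e → (Fin n → F)) _) ▸ h1)
        filter_upwards [(e.continuousAt hx).eventually h1] with y hy hys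
        exact hy ⟨e y, e.map_source hys⟩ rfl
      filter_upwards [hc, hφ, hℓ x hx s hs, e.open_source.mem_nhds hx] with y h1 h2 h3 h4
      simp only [h4, dite_true, LinearMap.smul_apply, LinearMap.smulRight_apply, h1, h2 h4, h3,
        smul_smul]
    · refine ⟨0, ?_⟩
      have hxK : x ∉ (fun u : chartTarget e => e.symm u.1) '' tsupport φ.1 := by
        rintro ⟨u, -, rfl⟩
        exact hx (e.map_target u.2)
      filter_upwards [hK.isClosed.isOpen_compl.mem_nhds hxK] with y hy
      rw [hzero y hy, LinearMap.zero_apply, zero_smul]⟩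
  map_add' φ ψ := by
    apply Subtype.ext
    funext x
    by_cases hx : x ∈ e.source <;> simp [hx, add_smul]
  map_smul' c φ := by
    apply Subtype.ext
    funext x
    by_cases hx : x ∈ e.source <;> simp [hx, mul_smul]

variable {E}

/-- The component of `ξ ∈ 𝒢(X, E)` along `ℓ` in the chart `e`: a distribution on the image of
`e`. -/
def coordDistribution (ξ : GeneralizedSection F n E) {e : OpenPartialHomeomorph X (Fin n → F)}
    (he : e ∈ IsManifold.maximalAtlas 𝓘(F, Fin n → F) ω X)
    {ℓ : ∀ x, Module.Dual ℂ (E.Stalk x)} (hℓ : E.IsDualSectionOn ℓ e.source) :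
    Distribution (chartTarget e) :=
  ξ.comp (testSection E he hℓ)

variable (F n X) in
/-- The cotangent bundle `T^*X`, as a set. -/
abbrev Cotangent : Type _ := Σ x : X, (TangentSpace 𝓘(F, Fin n → F) x →L[F] F)

/-- The wave front set of `ξ ∈ 𝒢(X, E)`: the union over all charts `e` and all sections `ℓ` of `E^*`
on the domain of `e` of the pullbacks under `e` of the wave front sets of the
corresponding components of `ξ`. -/
def waveFrontSet {κ : AddChar F Circle} (hκ : Continuous κ) (ξ : GeneralizedSection F n E) :
    Set (Cotangent F n X) :=
  {p | ∃ (e : OpenPartialHomeomorph X (Fin n → F))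
    (he : e ∈ IsManifold.maximalAtlas 𝓘(F, Fin n → F) ω X) (hx : p.1 ∈ e.source)
    (ℓ : ∀ x, Module.Dual ℂ (E.Stalk x)) (hℓ : E.IsDualSectionOn ℓ e.source)
    (v : (Fin n → F) →L[F] F),
    ((⟨e p.1, e.map_source hx⟩ : chartTarget e), v) ∈
        waveFrontSetOpen hκ (coordDistribution ξ he hℓ) ∧
      p.2 = v.comp (mfderiv 𝓘(F, Fin n → F) 𝓘(F, Fin n → F) e p.1)}

end TestSection

/-! ### Group actions -/

section Action

variable {m : ℕ} {G : Type*} [TopologicalSpace G] [Group G] [ChartedSpace (Fin m → F) G]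
  [MulAction G X]

variable (F n m) in
/-- The value `α(x) ∈ T_x X` at `x` of the vector field given by `α` in the Lie algebra of `G`: the
derivative at `1` of `g ↦ g • x`, applied to `α`. -/
def infinitesimalAction (α : GroupLieAlgebra 𝓘(F, Fin m → F) G) (x : X) :
    TangentSpace 𝓘(F, Fin n → F) x :=
  one_smul G x ▸ mfderiv 𝓘(F, Fin m → F) 𝓘(F, Fin n → F) (fun g : G => g • x) 1 α

variable [IsUltrametricDist F] [IsManifold 𝓘(F, Fin n → F) ω X]
  [ContMDiffSMul 𝓘(F, Fin m → F) 𝓘(F, Fin n → F) ω G X]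
  {E : LocallyConstantSheaf.{u, w} X} (τ : E.Equivariant G)

variable (F n m) in
/-- The action of `g⁻¹` on `𝒮(X, D_X ⊗ E^*)`, i.e. pullback of test sections along `g`. -/
def translate (g : G) : DualTestSections F n E →ₗ[ℂ] DualTestSections F n E where
  toFun f := ⟨fun x => (Density.pullback
      (mfderiv 𝓘(F, Fin n → F) 𝓘(F, Fin n → F) (fun y : X => g • y) x)).comp
        ((f.1 (g • x)).comp (τ.act g x)), by
    have hg : ContMDiff 𝓘(F, Fin n → F) 𝓘(F, Fin n → F) ω (fun y : X => g • y) :=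
      ContMDiffSMul.contMDiff_const_smul (I := 𝓘(F, Fin m → F)) g
    have hg' : ContMDiff 𝓘(F, Fin n → F) 𝓘(F, Fin n → F) ω (fun y : X => g⁻¹ • y) :=
      ContMDiffSMul.contMDiff_const_smul (I := 𝓘(F, Fin m → F)) g⁻¹
    refine ⟨fun x s hs e he hx => ?_, ?_⟩
    · obtain ⟨s', hs', hs'g⟩ := τ.exists_translate g hs hg'.continuous
      set e₀ := chartAt (Fin n → F) (g • x) with he₀
      have hx₀ : g • x ∈ e₀.source := mem_chart_source _ _
      have hm₀ : e₀ ∈ IsManifold.maximalAtlas 𝓘(F, Fin n → F) ω X :=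
        IsManifold.chart_mem_maximalAtlas _
      obtain ⟨c, hc⟩ := f.2.1 (g • x) s' hs' e₀ hm₀ hx₀
      have hcomp : ∀ y : X, g • y ∈ e₀.source →
          mfderiv 𝓘(F, Fin n → F) 𝓘(F, Fin n → F) (e₀ ∘ fun y : X => g • y) y =
          (mfderiv 𝓘(F, Fin n → F) 𝓘(F, Fin n → F) e₀ (g • y)).comp
            (mfderiv 𝓘(F, Fin n → F) 𝓘(F, Fin n → F) (fun y : X => g • y) y) := by
        intro y hy
        exact mfderiv_comp y ((contMDiffAt_of_mem_maximalAtlas hm₀ hy).mdifferentiableAt (by simp))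
          (hg.mdifferentiableAt (by simp))
      have hginj : Function.Injective
          (mfderiv 𝓘(F, Fin n → F) 𝓘(F, Fin n → F) (fun y : X => g • y) x) := by
        have h1 := mfderiv_comp x (I := 𝓘(F, Fin n → F)) (I' := 𝓘(F, Fin n → F))
          (I'' := 𝓘(F, Fin n → F)) (g := fun y : X => g⁻¹ • y) (f := fun y : X => g • y)
          (hg'.mdifferentiableAt (by simp)) (hg.mdifferentiableAt (by simp))
        have h2 : (fun y : X => g⁻¹ • y) ∘ (fun y : X => g • y) = id := by
          funext y; simp
        rw [h2, mfderiv_id] at h1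
        intro a b hab
        have h3 := fun a => congrArg (fun T : (Fin n → F) →L[F] (Fin n → F) => T a) h1
        have ha := h3 a
        have hb := h3 b
        refine Eq.trans ha (Eq.trans ?_ hb.symm)
        exact congrArg (mfderiv 𝓘(F, Fin n → F) 𝓘(F, Fin n → F)
          (fun y : X => g⁻¹ • y) (g • x)) hab
      obtain ⟨c', hc'⟩ := chartDensity_eventuallyEq (h := e₀ ∘ fun y : X => g • y) (k := e) (x := x)
        ((contMDiffAt_of_mem_maximalAtlas hm₀ hx₀).comp x hg.contMDiffAt)
        (contMDiffAt_of_mem_maximalAtlas he hx)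
        (bijective_mfderiv_of_mem_maximalAtlas he hx).1
        (by
          rw [hcomp x hx₀]
          exact (bijective_mfderiv_of_mem_maximalAtlas hm₀ hx₀).1.comp hginj)
      refine ⟨c * c', ?_⟩
      have hgc := (hg.continuous.continuousAt (x := x))
      filter_upwards [hc', hgc.eventually hc, hgc.eventually (e₀.open_source.mem_nhds hx₀)]
        with y h1 h2 h3
      have h4 : chartDensity (e₀ ∘ fun y : X => g • y) y = Density.pullback
          (mfderiv 𝓘(F, Fin n → F) 𝓘(F, Fin n → F) (fun y : X => g • y) y)
          (chartDensity e₀ (g • y)) := by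
        unfold chartDensity
        rw [hcomp y h3]
        rfl
      rw [mul_smul, ← h1, h4, ← map_smul, ← h2, hs'g]
      rfl
    · obtain ⟨-, K, hK, hfK⟩ := f.2
      refine ⟨(fun y : X => g⁻¹ • y) '' K, hK.image hg'.continuous, fun x hx => ?_⟩
      have : g • x ∉ K := fun h => hx ⟨g • x, h, by simp⟩
      simp only [hfK _ this, LinearMap.zero_comp, LinearMap.comp_zero]⟩
  map_add' f f' := by
    apply Subtype.ext
    funext x
    ext a : 1
    simp
  map_smul' c f := by
    apply Subtype.ext
    funext x
    ext a : 1
    simp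

/-- `ξ ∈ 𝒢(X, E)` is `G`-invariant. -/
def IsInvariant (ξ : GeneralizedSection F n E) : Prop :=
  ∀ (g : G) (f : DualTestSections F n E), ξ (translate F n m τ g f) = ξ f

end Action

end Manifold

end WaveFront

end

/-!
The theorem is an instance of nonstationary phase. Let `α` be an element of the Lie algebra of `G` and
let `v` be a covector at `x₀`, given in a chart `e`, that does not vanish on `α(x₀)`. It has to be
shown that `⟨ξ, φ κ(lam w ·)⟩ = 0` for every amplitude `φ` supported near `x₀`, every `w` near `v` and
every sufficiently large `lam`. No exponential map is needed: any analytic curve `c` in `G`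
with `c 0 = 1` and velocity `α` will do.

By invariance, `ξ` takes the same value on a test section and on its translates by `c t`. For `t` in
a small ball, which may depend on `φ` but not on `lam` and `w`, translation by `c t` changes
nothing but the phase:
* the amplitude `φ` is compactly supported and locally constant, hence invariant under a neighbourhood
  of `1` in `G` (`eventually_forall_smul_eq`);
* the Haar measure `e^*(dx)` is preserved near `x₀`, since the Jacobian of `c t` is close to `1` and
  hence has modulus `1` (`eventually_pullback_chartDensity`);
* the section `ℓ` of `E^*` is preserved near `x₀`, since `G` acts continuously on the étalé space, in
  which the constant sections are open (`Equivariant.eventually_dual_comp_act`).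

The phase becomes `κ(lam h(t))` with `h(t) = w(e(c t • x))`. Strict differentiability at
`(t, x) = (0, x₀)` and the ultrametric inequality show that `h` multiplies distances by the constant
`‖v(α(x₀))‖` (`exists_norm_sub_eq_of_hasStrictFDerivAt`). Such a map permutes the cosets of
small balls up to scaling and translation, so the sum of `κ(lam h(t))` over coset representatives
`t` is the sum of a nontrivial character over a finite group, which vanishes
(`exists_finset_sum_addChar_eq_zero`). The representatives depend neither on `x` nor on `w`.
Thus finitely many translates of the test section add up to zero, and `ξ` vanishes on it.
-/

namespace WaveFront

/-! ### Exponential sums over a ball -/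

/-- A nontrivial additive character, restricted to a ball of radius `r` and composed with an
isometric map on that ball, sums to zero over a suitable finite set of points, which does not depend
on the map. The points represent the cosets, in the ball of radius `r`, of a smaller ball on which
the character is trivial: isometries permute these cosets up to a translation. -/
theorem exists_finset_sum_addChar_eq_zero {F : Type*} [NontriviallyNormedField F]
    [IsUltrametricDist F] [LocallyCompactSpace F] {κ : AddChar F Circle} (hκ : Continuous κ)
    {r : ℝ} (hr : 0 < r) {μ : F} (hμ : ∃ s : F, ‖s‖ ≤ r ∧ κ (μ * s) ≠ 1) :
    ∃ T : Finset F, T.Nonempty ∧ (∀ t ∈ T, ‖t‖ ≤ r) ∧ ∀ H : F → F,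
      (∀ s t : F, ‖s‖ ≤ r → ‖t‖ ≤ r → ‖H s - H t‖ = ‖s - t‖) →
        ∑ t ∈ T, ((κ (μ * H t) : Circle) : ℂ) = 0 := by
  classical
  have : ProperSpace F := ProperSpace.of_locallyCompactSpace F
  obtain ⟨δ, hδ, hδκ⟩ : ∃ δ > 0, ∀ s : F, ‖s‖ < δ → κ (μ * s) = 1 := by
    have h1 := ((addChar_isLocallyConstant hκ).comp_continuous (continuous_const_mul μ))
    have h2 := (IsLocallyConstant.iff_eventually_eq _).1 h1 0
    obtain ⟨δ, hδ, h3⟩ := Metric.eventually_nhds_iff_ball.1 h2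
    refine ⟨δ, hδ, fun s hs => ?_⟩
    simpa using h3 s (by simpa using hs)
  let P : AddSubgroup F := (IsUltrametricDist.closedBall_openAddSubgroup F hr).toAddSubgroup
  have hP : ∀ s : F, s ∈ P ↔ ‖s‖ ≤ r := fun s => mem_closedBall_zero_iff
  let Q' : AddSubgroup F := (IsUltrametricDist.ball_openAddSubgroup F hδ).toAddSubgroup
  have hQ' : ∀ s : F, s ∈ Q' ↔ ‖s‖ < δ := fun s => mem_ball_zero_iff
  have : CompactSpace P := isCompact_iff_compactSpace.1 (isCompact_closedBall (0 : F) r)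
  let Q : AddSubgroup P := Q'.addSubgroupOf P
  have hQ : ∀ s : P, s ∈ Q ↔ ‖(s : F)‖ < δ := fun s => hQ' s
  have : Finite (P ⧸ Q) := by
    apply AddSubgroup.quotient_finite_of_isOpen
    exact (Metric.isOpen_ball (x := (0 : F)) (ε := δ)).preimage continuous_subtype_val
  have := Fintype.ofFinite (P ⧸ Q)
  let f : P →+ Additive Circle :=
    κ.toAddMonoidHom.comp ((AddMonoidHom.mulLeft μ).comp P.subtype)
  have hf : ∀ s : P, f s = Additive.ofMul (κ (μ * s)) := fun s => rfl
  let ψ : AddChar (P ⧸ Q) ℂ := Circle.coeHom.compAddChar (AddChar.toAddMonoidHomEquiv.symm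
    (QuotientAddGroup.lift Q f (fun s hs => by
      rw [AddMonoidHom.mem_ker, hf, hδκ _ ((hQ s).1 hs)]; rfl)))
  have hψ : ∀ s : P, ψ (s : P ⧸ Q) = ((κ (μ * s) : Circle) : ℂ) := fun s => rfl
  have hψ1 : ψ ≠ 1 := by
    obtain ⟨s, hs, hne⟩ := hμ
    intro h
    apply hne
    have h1 := hψ ⟨s, (hP s).2 hs⟩
    rw [h, AddChar.one_apply] at h1
    exact (Circle.ext (by simpa using h1)).symm
  let R : P ⧸ Q → F := fun q => (q.out : P)
  have hRr : ∀ q, ‖R q‖ ≤ r := fun q => (hP _).1 (q.out : P).2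
  have hR : Function.Injective R := fun q q' h => Quotient.out_injective (Subtype.ext h)
  refine ⟨Finset.univ.image R, ⟨R 0, by simp⟩, by simpa using hRr, fun H hH => ?_⟩
  rw [Finset.sum_image hR.injOn]
  have h0 : ‖(0 : F)‖ ≤ r := by simpa using hr.le
  -- Being isometric, `H - H 0` induces an injection of the finite set of cosets into itself.
  let K : P ⧸ Q → P := fun q => ⟨H (R q) - H 0, (hP _).2 (by
    rw [hH _ _ (hRr q) h0, sub_zero]; exact hRr q)⟩
  have hK : Function.Injective fun q => (K q : P ⧸ Q) := by
    intro q q' h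
    have h1 : ‖R q - R q'‖ < δ := by
      have h2 := (hQ _).1 (QuotientAddGroup.eq.1 h)
      have h3 : ((-K q + K q' : P) : F) = H (R q') - H (R q) := by
        change -(H (R q) - H 0) + (H (R q') - H 0) = _
        ring
      rw [h3, hH _ _ (hRr _) (hRr _), norm_sub_rev] at h2
      exact h2
    have h4 : ((q.out : P) : P ⧸ Q) = ((q'.out : P) : P ⧸ Q) := by
      rw [QuotientAddGroup.eq, hQ]
      have h5 : ((-q.out + q'.out : P) : F) = R q' - R q := by
        change -(R q) + R q' = _
        ring
      rwa [h5, norm_sub_rev]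
    simpa using h4
  have hKb : Function.Bijective fun q => (K q : P ⧸ Q) := Finite.injective_iff_bijective.1 hK
  calc ∑ q, ((κ (μ * H (R q)) : Circle) : ℂ)
      = ∑ q, ((κ (μ * H 0) : Circle) : ℂ) * ψ (K q) := by
        refine Finset.sum_congr rfl fun q _ => ?_
        rw [hψ, ← Circle.coe_mul, ← AddChar.map_add_eq_mul]
        congr 3
        change _ = μ * H 0 + μ * (H (R q) - H 0)
        ring
    _ = ((κ (μ * H 0) : Circle) : ℂ) * ∑ q, ψ q := by
        rw [← Finset.mul_sum, hKb.sum_comp ψ]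
    _ = 0 := by rw [AddChar.sum_eq_zero_of_ne_one hψ1, mul_zero]

/-! ### Uniform invariance of compactly supported locally constant functions -/

/-- A compactly supported locally constant function is invariant under all sufficiently small
elements of a topological group. -/
theorem eventually_forall_smul_eq {G X Y : Type*} [TopologicalSpace G] [Group G]
    [IsTopologicalGroup G] [TopologicalSpace X] [MulAction G X] [ContinuousSMul G X] [Zero Y]
    {f : X → Y} (hf : IsLocallyConstant f) {K : Set X} (hK : IsCompact K)
    (hfK : ∀ x ∉ K, f x = 0) : ∀ᶠ g in 𝓝 (1 : G), ∀ x, f (g • x) = f x := by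
  have h1 : ∀ᶠ g in 𝓝 (1 : G), ∀ x ∈ K, f (g • x) = f x := by
    apply hK.eventually_forall_of_forall_eventually
    intro x _
    have h2 := (IsLocallyConstant.iff_eventually_eq _).1
      (hf.comp_continuous (continuous_smul (M := G) (X := X))) (1, x)
    have h3 := (IsLocallyConstant.iff_eventually_eq _).1
      (hf.comp_continuous (continuous_snd (X := G) (Y := X))) (1, x)
    filter_upwards [h2, h3] with p hp hp'
    simp only [Function.comp_apply, one_smul] at hp hp'
    rw [hp, hp']
  have h2 : ∀ᶠ g in 𝓝 (1 : G), ∀ x ∈ K, f (g⁻¹ • x) = f x := by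
    have : Filter.Tendsto (fun g : G => g⁻¹) (𝓝 1) (𝓝 1) := by
      simpa using (continuous_inv (G := G)).tendsto 1
    exact this.eventually h1
  filter_upwards [h1, h2] with g hg hg' x
  by_cases hx : x ∈ K
  · exact hg x hx
  -- Outside `K`, the invariance under `g⁻¹` at the point `g • x` is used instead.
  by_cases hgx : g • x ∈ K
  · have := hg' _ hgx
    rw [inv_smul_smul] at this
    exact this.symm
  · rw [hfK _ hx, hfK _ hgx]

end WaveFront

namespace WaveFront

universe u w

/-! ### Invariance of sections of an equivariant locally constant sheaf -/

namespace LocallyConstantSheaf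

variable {X : Type u} [TopologicalSpace X] {E : LocallyConstantSheaf.{u, w} X}
  {G : Type*} [Group G] [TopologicalSpace G] [MulAction G X]

/-- The action of group elements near `1` transports a local trivialization of an equivariant locally
constant sheaf to itself: the image of a constant section is an open set of the étalé space, which
the continuous action can only leave away from `1`. -/
theorem Equivariant.eventually_act_trivialization (τ : E.Equivariant G) {U : Set X} {x₀ : X}
    (hU : IsOpen U) (hx₀ : x₀ ∈ U) {V : Type*} [AddCommGroup V] [Module ℂ V]
    (T : ∀ x : U, V ≃ₗ[ℂ] E.Stalk x) (a : V)
    (hT : Topology.IsOpenEmbedding fun x : U => E.pt x (T x a)) :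
    ∀ᶠ p in 𝓝 ((1 : G), x₀), ∃ (h : p.2 ∈ U) (h' : p.1 • p.2 ∈ U),
      τ.act p.1 p.2 (T ⟨p.2, h⟩ a) = T ⟨p.1 • p.2, h'⟩ a := by
  have hemb : Topology.IsOpenEmbedding fun q : G × U => ((q.1, (q.2 : X)) : G × X) :=
    Topology.IsOpenEmbedding.id.prodMap hU.isOpenEmbedding_subtypeVal
  rw [← hemb.map_nhds_eq (1, ⟨x₀, hx₀⟩), Filter.eventually_map]
  have hc : Continuous fun q : G × U =>
      E.pt (q.1 • (q.2 : X)) (τ.act q.1 q.2 (T q.2 a)) :=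
    τ.continuous_act.comp (continuous_fst.prodMk (hT.continuous.comp continuous_snd))
  have hmem : E.pt ((1 : G) • x₀) (τ.act 1 x₀ (T ⟨x₀, hx₀⟩ a)) ∈
      Set.range fun x : U => E.pt x (T x a) := by
    rw [τ.act_one]
    exact ⟨⟨x₀, hx₀⟩, rfl⟩
  filter_upwards [hc.continuousAt.eventually (hT.isOpen_range.mem_nhds hmem)] with q hq
  obtain ⟨y, hy⟩ := hq
  have h1 : (y : X) = q.1 • (q.2 : X) := (Sigma.mk.inj hy).1
  have h' : q.1 • (q.2 : X) ∈ U := h1 ▸ y.2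
  obtain rfl : y = ⟨q.1 • (q.2 : X), h'⟩ := Subtype.ext h1
  exact ⟨q.2.2, h', (eq_of_heq (Sigma.mk.inj hy).2).symm⟩

/-- A section of the dual of an equivariant locally constant sheaf is locally invariant. -/
theorem Equivariant.eventually_dual_comp_act [ContinuousSMul G X] (τ : E.Equivariant G) {S : Set X}
    {x₀ : X} (hx₀ : x₀ ∈ S) {ℓ : ∀ x, Module.Dual ℂ (E.Stalk x)} (hℓ : E.IsDualSectionOn ℓ S) :
    ∀ᶠ p in 𝓝 ((1 : G), x₀), (ℓ (p.1 • p.2)).comp (τ.act p.1 p.2) = ℓ p.2 := by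
  classical
  obtain ⟨U, hU, hxU, T, hT⟩ := E.locally_constant x₀
  have hconst : ∀ a : E.Stalk x₀,
      ∀ᶠ y in 𝓝 x₀, ∀ h : y ∈ U, ℓ y (T ⟨y, h⟩ a) = ℓ x₀ (T ⟨x₀, hxU⟩ a) := by
    intro a
    let s : ∀ x, E.Stalk x := fun x => if h : x ∈ U then T ⟨x, h⟩ a else 0
    have hs : E.IsSectionAt s x₀ := by
      have h1 : ContinuousAt ((fun y => E.pt y (s y)) ∘ ((↑) : U → X)) ⟨x₀, hxU⟩ := by
        have : (fun y => E.pt y (s y)) ∘ ((↑) : U → X) = fun x : U => E.pt x (T x a) := by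
          funext x
          simp [s, x.2]
        rw [this]
        exact (show Topology.IsOpenEmbedding fun x : U => E.pt x (T x a) from
          hT a).continuous.continuousAt
      exact (hU.isOpenEmbedding_subtypeVal.continuousAt_iff).1 h1
    filter_upwards [hℓ x₀ hx₀ s hs] with y hy h
    simpa [s, h, hxU] using hy
  let b := Module.finBasis ℂ (E.Stalk x₀)
  have hfst : Filter.Tendsto (fun p : G × X => p.1 • p.2) (𝓝 (1, x₀)) (𝓝 x₀) := by
    simpa using (continuous_smul (M := G) (X := X)).tendsto (1, x₀)
  have hact := Filter.eventually_all.2 fun i =>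
    τ.eventually_act_trivialization hU hxU T (b i) (hT (b i))
  have hℓ1 := hfst.eventually (Filter.eventually_all.2 fun i => hconst (b i))
  have hℓ2 := (continuous_snd (X := G) (Y := X)).continuousAt (x := (1, x₀)) |>.eventually
    (Filter.eventually_all.2 fun i => hconst (b i))
  have hpU := (continuous_snd (X := G) (Y := X)).continuousAt (x := (1, x₀)) |>.eventually
    (hU.mem_nhds hxU)
  filter_upwards [hact, hℓ1, hℓ2, hpU] with p h1 h2 h3 h
  refine (b.map (T ⟨p.2, h⟩)).ext fun i => ?_
  obtain ⟨_, h', h4⟩ := h1 i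
  rw [Module.Basis.map_apply, LinearMap.comp_apply, h4, h2 i h', h3 i h]

end LocallyConstantSheaf

end WaveFront

namespace WaveFront

universe u

/-! ### A curve of group elements in an analytic chart -/

section Flow

variable {F : Type*} [NontriviallyNormedField F]
  {m n : ℕ} {G : Type*} [TopologicalSpace G] [Group G] [ChartedSpace (Fin m → F) G]
  {X : Type u} [TopologicalSpace X] [ChartedSpace (Fin n → F) X] [MulAction G X]

/-- Every vector `α` of the Lie algebra is the velocity at `0` of an analytic curve through `1`. -/
theorem exists_curve_of_groupLieAlgebra [LieGroup 𝓘(F, Fin m → F) ω G]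
    (α : GroupLieAlgebra 𝓘(F, Fin m → F) G) :
    ∃ c : F → G, c 0 = 1 ∧ ContMDiffAt 𝓘(F, F) 𝓘(F, Fin m → F) ω c 0 ∧
      (mfderiv 𝓘(F, F) 𝓘(F, Fin m → F) c 0 (1 : F) : Fin m → F) = α := by
  set q := chartAt (Fin m → F) (1 : G) with hq
  have hq1 : (1 : G) ∈ q.source := mem_chart_source _ _
  have hqm : q ∈ IsManifold.maximalAtlas 𝓘(F, Fin m → F) ω G := IsManifold.chart_mem_maximalAtlas _
  have hmd : q.MDifferentiable 𝓘(F, Fin m → F) 𝓘(F, Fin m → F) :=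
    ⟨(contMDiffOn_of_mem_maximalAtlas hqm).mdifferentiableOn (by simp),
      (contMDiffOn_symm_of_mem_maximalAtlas hqm).mdifferentiableOn (by simp)⟩
  let β : Fin m → F := mfderiv 𝓘(F, Fin m → F) 𝓘(F, Fin m → F) q 1 α
  let l : F → (Fin m → F) := fun t => q 1 + t • β
  have hl0 : l 0 = q 1 := by simp [l]
  have hsymm : ContMDiffAt 𝓘(F, Fin m → F) 𝓘(F, Fin m → F) ω q.symm (l 0) := by
    rw [hl0]
    exact contMDiffAt_symm_of_mem_maximalAtlas hqm (q.map_source hq1)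
  have hlc : ContMDiffAt 𝓘(F, F) 𝓘(F, Fin m → F) ω l 0 := by
    apply ContDiffAt.contMDiffAt
    fun_prop
  have hld : HasFDerivAt l ((1 : F →L[F] F).smulRight β) 0 :=
    ((1 : F →L[F] F).smulRight β).hasFDerivAt.const_add (q 1)
  refine ⟨q.symm ∘ l, by simp [hl0, q.left_inv hq1], hsymm.comp 0 hlc, ?_⟩
  rw [mfderiv_comp (0 : F) (hsymm.mdifferentiableAt (by simp)) (hlc.mdifferentiableAt (by simp)),
    mfderiv_eq_fderiv, hld.fderiv]
  have h1 := hmd.symm_comp_deriv hq1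
  rw [← hl0] at h1
  have h2 := congrArg (fun T : (Fin m → F) →L[F] (Fin m → F) => T α) h1
  refine Eq.trans ?_ h2
  change mfderiv 𝓘(F, Fin m → F) 𝓘(F, Fin m → F) q.symm (l 0) ((1 : F) • β) = _
  rw [one_smul]
  rfl

/-- The action of a curve `c` in `G`, in the coordinates given by `e`. -/
noncomputable def chartFlow (c : F → G) (e : OpenPartialHomeomorph X (Fin n → F))
    (p : F × (Fin n → F)) : Fin n → F :=
  e (c p.1 • e.symm p.2)

variable [ContMDiffSMul 𝓘(F, Fin m → F) 𝓘(F, Fin n → F) ω G X]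
  {c : F → G} {e : OpenPartialHomeomorph X (Fin n → F)} {x₀ : X}

theorem contDiffAt_chartFlow (hc0 : c 0 = 1)
    (hc : ContMDiffAt 𝓘(F, F) 𝓘(F, Fin m → F) ω c 0)
    (he : e ∈ IsManifold.maximalAtlas 𝓘(F, Fin n → F) ω X) (hx₀ : x₀ ∈ e.source) :
    ContDiffAt F ω (chartFlow c e) (0, e x₀) := by
  have h1 : ContMDiffAt (𝓘(F, F).prod 𝓘(F, Fin n → F)) 𝓘(F, Fin m → F) ω
      (fun p : F × (Fin n → F) => c p.1) (0, e x₀) :=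
    ContMDiffAt.comp (g := c) (f := Prod.fst) (0, e x₀) hc contMDiffAt_fst
  have h2 : ContMDiffAt (𝓘(F, F).prod 𝓘(F, Fin n → F)) 𝓘(F, Fin n → F) ω
      (fun p : F × (Fin n → F) => e.symm p.2) (0, e x₀) :=
    ContMDiffAt.comp (g := e.symm) (f := Prod.snd) (0, e x₀)
      (contMDiffAt_symm_of_mem_maximalAtlas he (e.map_source hx₀)) contMDiffAt_snd
  have h3 := (ContMDiffSMul.contMDiff_smul (I := 𝓘(F, Fin m → F)) (I' := 𝓘(F, Fin n → F))
    (n := ω) (G := G) (M := X)).contMDiffAt.comp (0, e x₀) (h1.prodMk h2)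
  have h4 : ContMDiffAt (𝓘(F, F).prod 𝓘(F, Fin n → F)) 𝓘(F, Fin n → F) ω (chartFlow c e)
      (0, e x₀) := by
    refine ContMDiffAt.comp (g := e) (0, e x₀) (contMDiffAt_of_mem_maximalAtlas he ?_) h3
    simpa [hc0, e.left_inv hx₀] using hx₀
  rw [← modelWithCornersSelf_prod, chartedSpaceSelf_prod] at h4
  exact h4.contDiffAt

/-- The derivative of the flow along the curve is the infinitesimal action of its velocity. -/
theorem fderiv_chartFlow [IsManifold 𝓘(F, Fin n → F) ω X] (hc0 : c 0 = 1)
    (hc : ContMDiffAt 𝓘(F, F) 𝓘(F, Fin m → F) ω c 0)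
    (he : e ∈ IsManifold.maximalAtlas 𝓘(F, Fin n → F) ω X) (hx₀ : x₀ ∈ e.source)
    {α : GroupLieAlgebra 𝓘(F, Fin m → F) G}
    (hα : (mfderiv 𝓘(F, F) 𝓘(F, Fin m → F) c 0 (1 : F) : Fin m → F) = α) :
    fderiv F (chartFlow c e) (0, e x₀) (1, 0) =
      mfderiv 𝓘(F, Fin n → F) 𝓘(F, Fin n → F) e x₀ (infinitesimalAction F n m α x₀) := by
  -- The value of the vector field is transported from `T_{1 • x₀} X` to `T_{x₀} X`.
  have hcast : ∀ (y x : X) (h : y = x) (w : TangentSpace 𝓘(F, Fin n → F) y),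
      (mfderiv 𝓘(F, Fin n → F) 𝓘(F, Fin n → F) e x (h ▸ w) : Fin n → F) =
        mfderiv 𝓘(F, Fin n → F) 𝓘(F, Fin n → F) e y w := by
    rintro y _ rfl w
    rfl
  have h1 : HasFDerivAt (fun t : F => chartFlow c e (t, e x₀))
      ((fderiv F (chartFlow c e) (0, e x₀)).comp (ContinuousLinearMap.inl F F (Fin n → F))) 0 :=
    HasFDerivAt.comp (g := chartFlow c e) (f := fun t : F => (t, e x₀)) (0 : F)
      ((contDiffAt_chartFlow hc0 hc he hx₀).differentiableAt (by simp)).hasFDerivAt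
      (hasFDerivAt_prodMk_left (𝕜 := F) (0 : F) (e x₀))
  let o : G → X := fun g => g • x₀
  have ho : ContMDiff 𝓘(F, Fin m → F) 𝓘(F, Fin n → F) ω o :=
    (ContMDiffSMul.contMDiff_smul (I := 𝓘(F, Fin m → F)) (I' := 𝓘(F, Fin n → F))
      (n := ω) (G := G) (M := X)).comp (contMDiff_id.prodMk contMDiff_const)
  have hoc : o (c 0) ∈ e.source := by simpa [o, hc0] using hx₀
  have h2 : mfderiv 𝓘(F, F) 𝓘(F, Fin n → F) (e ∘ o ∘ c) 0 =
      (mfderiv 𝓘(F, Fin n → F) 𝓘(F, Fin n → F) e (o (c 0))).comp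
        ((mfderiv 𝓘(F, Fin m → F) 𝓘(F, Fin n → F) o (c 0)).comp
          (mfderiv 𝓘(F, F) 𝓘(F, Fin m → F) c 0)) := by
    rw [← mfderiv_comp (0 : F) (ho.mdifferentiableAt (by simp)) (hc.mdifferentiableAt (by simp))]
    exact mfderiv_comp (0 : F) ((contMDiffAt_of_mem_maximalAtlas he hoc).mdifferentiableAt
      (by simp)) ((ho.contMDiffAt.comp 0 hc).mdifferentiableAt (by simp))
  have h3 : (fun t : F => chartFlow c e (t, e x₀)) = e ∘ o ∘ c := by
    funext t
    simp [chartFlow, o, e.left_inv hx₀]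
  rw [h3] at h1
  rw [mfderiv_eq_fderiv, h1.fderiv] at h2
  have h4 := congrArg (fun T : F →L[F] (Fin n → F) => T 1) h2
  refine Eq.trans h4 ?_
  unfold infinitesimalAction
  rw [hcast]
  have key : ∀ g : G, g = 1 → ∀ w : Fin m → F, w = α →
      (mfderiv 𝓘(F, Fin n → F) 𝓘(F, Fin n → F) e (o g)
        (mfderiv 𝓘(F, Fin m → F) 𝓘(F, Fin n → F) o g w) : Fin n → F) =
      mfderiv 𝓘(F, Fin n → F) 𝓘(F, Fin n → F) e ((1 : G) • x₀)
        (mfderiv 𝓘(F, Fin m → F) 𝓘(F, Fin n → F) o 1 α) := by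
    rintro _ rfl _ rfl
    rfl
  exact key (c 0) hc0 _ hα

end Flow

/-- A function of the form `p ↦ w (a p)`, where `a` is strictly differentiable at `(0, u₀)` and `w` is
close to `v`, has constant dilation factor in the first variable near `0`. This is a
consequence of the ultrametric inequality, and it holds uniformly in `w` and in the second variable. -/
theorem exists_norm_sub_eq_of_hasStrictFDerivAt {F : Type*} [NontriviallyNormedField F]
    [IsUltrametricDist F] {V W : Type*} [NormedAddCommGroup V] [NormedSpace F V]
    [NormedAddCommGroup W] [NormedSpace F W] {a : F × V → W} {u₀ : V} {a' : F × V →L[F] W}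
    (ha : HasStrictFDerivAt a a' (0, u₀)) (v : W →L[F] F) (hη : v (a' (1, 0)) ≠ 0) :
    ∃ ε > 0, ∀ w ∈ Metric.ball v ε, ∀ u ∈ Metric.ball u₀ ε, ∀ s t : F, ‖s‖ < ε → ‖t‖ < ε →
      ‖w (a (s, u)) - w (a (t, u))‖ = ‖v (a' (1, 0))‖ * ‖s - t‖ := by
  set η := v (a' (1, 0)) with hη_def
  have h1 : HasStrictFDerivAt (fun p : (W →L[F] F) × (F × V) => p.1 (a p.2)) _ (v, (0, u₀)) :=
    hasStrictFDerivAt_fst.clm_apply (ha.comp (v, (0, u₀)) hasStrictFDerivAt_snd)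
  have h2 := h1.isLittleO.bound (half_pos (norm_pos_iff.2 hη))
  obtain ⟨ε, hε, h3⟩ := Metric.eventually_nhds_iff_ball.1 h2
  refine ⟨ε, hε, fun w hw u hu s t hs ht => ?_⟩
  have hmem : ∀ r : F, ‖r‖ < ε → (w, (r, u)) ∈ Metric.ball (v, ((0 : F), u₀)) ε := by
    intro r hr
    simp only [Metric.mem_ball, Prod.dist_eq, max_lt_iff] at hw hu ⊢
    exact ⟨hw, by simpa using hr, hu⟩
  have h4 := h3 ((w, (s, u)), (w, (t, u))) (by
    have hs' := hmem s hs
    have ht' := hmem t ht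
    rw [Metric.mem_ball] at hs' ht' ⊢
    rw [Prod.dist_eq]
    exact max_lt hs' ht')
  have h5 : (s - t, (0 : V)) = (s - t) • ((1 : F), (0 : V)) := by simp
  have h6 : ‖w (a (s, u)) - w (a (t, u)) - (s - t) * η‖ ≤ ‖η‖ / 2 * ‖s - t‖ := by
    have h7 : a' (s - t, 0) = (s - t) • a' (1, 0) := by rw [h5, map_smul]
    simpa [Prod.norm_def, h7, ← hη_def] using h4
  rcases eq_or_ne s t with rfl | hst
  · simp
  have hpos : 0 < ‖η‖ * ‖s - t‖ := mul_pos (norm_pos_iff.2 hη) (norm_pos_iff.2 (sub_ne_zero.2 hst))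
  have h7 : ‖w (a (s, u)) - w (a (t, u)) - (s - t) * η‖ < ‖(s - t) * η‖ := by
    rw [norm_mul]
    linarith
  have h8 := IsUltrametricDist.norm_add_eq_max_of_norm_ne_norm h7.ne
  rw [sub_add_cancel, max_eq_right h7.le, norm_mul] at h8
  rw [h8, mul_comm]

section Density

variable {F : Type*} [NontriviallyNormedField F] [IsUltrametricDist F] [LocallyCompactSpace F]
  {m n : ℕ} {G : Type*} [TopologicalSpace G] [Group G] [ChartedSpace (Fin m → F) G]
  {X : Type u} [TopologicalSpace X] [ChartedSpace (Fin n → F) X] [MulAction G X]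
  [ContMDiffSMul 𝓘(F, Fin m → F) 𝓘(F, Fin n → F) ω G X]
  {c : F → G} {e : OpenPartialHomeomorph X (Fin n → F)} {x₀ : X}

/-- Elements of `G` close to `1` preserve the Haar measure of a chart: their Jacobian is close to `1`,
so that its modulus equals `1`. -/
theorem eventually_pullback_chartDensity (hc0 : c 0 = 1)
    (hc : ContMDiffAt 𝓘(F, F) 𝓘(F, Fin m → F) ω c 0)
    (he : e ∈ IsManifold.maximalAtlas 𝓘(F, Fin n → F) ω X) (hx₀ : x₀ ∈ e.source) :
    ∀ᶠ p in 𝓝 ((0 : F), x₀), Density.pullback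
      (mfderiv 𝓘(F, Fin n → F) 𝓘(F, Fin n → F) (fun y : X => c p.1 • y) p.2)
      (chartDensity e (c p.1 • p.2)) = chartDensity e p.2 := by
  have : ProperSpace F := ProperSpace.of_locallyCompactSpace F
  have : ContinuousSMul G X := ⟨(ContMDiffSMul.contMDiff_smul (I := 𝓘(F, Fin m → F))
    (I' := 𝓘(F, Fin n → F)) (n := ω) (G := G) (M := X)).continuous⟩
  have ha := contDiffAt_chartFlow hc0 hc he hx₀
  let D : F × (Fin n → F) → (Fin n → F) →L[F] (Fin n → F) := fun p =>
    (fderiv F (chartFlow c e) p).comp (ContinuousLinearMap.inr F F (Fin n → F))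
  have hDc : ContinuousAt D (0, e x₀) :=
    (ha.continuousAt_fderiv (by simp)).clm_comp continuousAt_const
  have hD : ∀ p, DifferentiableAt F (chartFlow c e) p →
      HasFDerivAt (fun z => chartFlow c e (p.1, z)) (D p) p.2 := fun p hp =>
    HasFDerivAt.comp (g := chartFlow c e) (f := fun z => (p.1, z)) p.2 hp.hasFDerivAt
      (hasFDerivAt_prodMk_right (𝕜 := F) p.1 p.2)
  -- At `t = 0` the flow is the identity near `e x₀`.
  have hD0 : D (0, e x₀) = ContinuousLinearMap.id F (Fin n → F) := by
    refine (hD (0, e x₀) (ha.differentiableAt (by simp))).unique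
      ((hasFDerivAt_id (e x₀)).congr_of_eventuallyEq ?_)
    filter_upwards [e.open_target.mem_nhds (e.map_source hx₀)] with z hz
    simp [chartFlow, hc0, e.right_inv hz]
  have hdet0 : (D (0, e x₀)).det = 1 := by
    rw [hD0]
    exact LinearMap.det_id
  have hdet := modulus_eventuallyEq
    (ContinuousLinearMap.continuous_det.continuousAt.comp hDc) (by simp [hdet0])
  have hmod1 : modulus (1 : F) = 1 := modulus_eq_one_of_norm (by simp)
  simp only [Function.comp_apply, hdet0, hmod1] at hdet
  have hdiff : ∀ᶠ p in 𝓝 ((0 : F), e x₀), DifferentiableAt F (chartFlow c e) p := by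
    have h1 : ContDiffAt F 1 (chartFlow c e) (0, e x₀) := ha.of_le (by simp)
    filter_upwards [h1.eventually (by simp)] with p hp
    exact hp.differentiableAt (by simp)
  have hcoord : Filter.Tendsto (fun p : F × X => (p.1, e p.2)) (𝓝 (0, x₀)) (𝓝 (0, e x₀)) :=
    continuousAt_fst.prodMk ((e.continuousAt hx₀).comp continuousAt_snd)
  have hact : Filter.Tendsto (fun p : F × X => c p.1 • p.2) (𝓝 (0, x₀)) (𝓝 x₀) := by
    have : ContinuousAt (fun p : F × X => c p.1 • p.2) (0, x₀) :=
      (ContinuousAt.comp (g := c) (f := Prod.fst) (x := ((0 : F), x₀)) hc.continuousAt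
        continuousAt_fst).smul continuousAt_snd
    simpa [ContinuousAt, hc0] using this
  filter_upwards [hcoord.eventually hdet, hcoord.eventually hdiff,
    hact.eventually (e.open_source.mem_nhds hx₀),
    continuousAt_snd.eventually (e.open_source.mem_nhds hx₀)] with p h1 h2 h3 h4
  have hg : ContMDiff 𝓘(F, Fin n → F) 𝓘(F, Fin n → F) ω (fun y : X => c p.1 • y) :=
    ContMDiffSMul.contMDiff_const_smul (I := 𝓘(F, Fin m → F)) (c p.1)
  have h5 : mfderiv 𝓘(F, Fin n → F) 𝓘(F, Fin n → F) (e ∘ fun y : X => c p.1 • y) p.2 =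
      (mfderiv 𝓘(F, Fin n → F) 𝓘(F, Fin n → F) e (c p.1 • p.2)).comp
        (mfderiv 𝓘(F, Fin n → F) 𝓘(F, Fin n → F) (fun y : X => c p.1 • y) p.2) :=
    mfderiv_comp p.2 ((contMDiffAt_of_mem_maximalAtlas he h3).mdifferentiableAt (by simp))
      (hg.mdifferentiableAt (by simp))
  have h6 : (e ∘ fun y : X => c p.1 • y) =ᶠ[𝓝 p.2]
      (fun z => chartFlow c e (p.1, z)) ∘ e := by
    filter_upwards [e.open_source.mem_nhds h4] with y hy
    simp [chartFlow, e.left_inv hy]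
  have h7 : HasFDerivAt (fun z => chartFlow c e (p.1, z)) (D (p.1, e p.2)) (e p.2) :=
    hD (p.1, e p.2) h2
  have h8 : mfderiv 𝓘(F, Fin n → F) 𝓘(F, Fin n → F) (e ∘ fun y : X => c p.1 • y) p.2 =
      (D (p.1, e p.2)).comp (mfderiv 𝓘(F, Fin n → F) 𝓘(F, Fin n → F) e p.2 :
        (Fin n → F) →L[F] (Fin n → F)) := by
    refine HasMFDerivAt.mfderiv (HasMFDerivAt.congr_of_eventuallyEq ?_ h6)
    exact HasMFDerivAt.comp (g := fun z => chartFlow c e (p.1, z)) p.2 h7.hasMFDerivAt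
      ((contMDiffAt_of_mem_maximalAtlas he h4).mdifferentiableAt (by simp)).hasMFDerivAt
  apply Subtype.ext
  funext L
  have h9 := det_comp' (D (p.1, e p.2)) (ContinuousLinearMap.comp
    (mfderiv 𝓘(F, Fin n → F) 𝓘(F, Fin n → F) e p.2) L : (Fin n → F) →L[F] (Fin n → F))
  have h10 : ContinuousLinearMap.comp (mfderiv 𝓘(F, Fin n → F) 𝓘(F, Fin n → F) e (c p.1 • p.2))
        (ContinuousLinearMap.comp (mfderiv 𝓘(F, Fin n → F) 𝓘(F, Fin n → F)
          (fun y : X => c p.1 • y) p.2) L) =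
      (D (p.1, e p.2)).comp (ContinuousLinearMap.comp
        (mfderiv 𝓘(F, Fin n → F) 𝓘(F, Fin n → F) e p.2) L :
          (Fin n → F) →L[F] (Fin n → F)) :=
    congrArg (fun T : (Fin n → F) →L[F] (Fin n → F) => T.comp L) (h5.symm.trans h8)
  change ((modulus (ContinuousLinearMap.det (M := Fin n → F) (R := F) _) : ℝ) : ℂ) =
    ((modulus (ContinuousLinearMap.det (M := Fin n → F) (R := F) (ContinuousLinearMap.comp
      (mfderiv 𝓘(F, Fin n → F) 𝓘(F, Fin n → F) e p.2) L)) : ℝ) : ℂ)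
  have h11 := congrArg modulus h9
  rw [modulus_mul, h1, one_mul] at h11
  refine congrArg (fun r : ℝ => (r : ℂ)) (Eq.trans ?_ h11)
  exact congrArg (fun M => modulus (ContinuousLinearMap.det (M := Fin n → F) (R := F) M)) h10

end Density

end WaveFront

namespace WaveFront

universe u w

/-! ### Invariant generalized sections are smooth in directions moved by the group -/

section Extend

variable {F : Type*} [NontriviallyNormedField F] {n : ℕ} {X : Type u} [TopologicalSpace X]

open scoped Classical in
/-- The function `φ ∘ e` on `X`, extended by zero, for a Schwartz function `φ` on the image of a
chart `e`. -/
noncomputable def extendChart (e : OpenPartialHomeomorph X (Fin n → F))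
    (φ : Schwartz (chartTarget e)) (x : X) : ℂ :=
  if hx : x ∈ e.source then φ.1 ⟨e x, e.map_source hx⟩ else 0

theorem exists_isCompact_extendChart (e : OpenPartialHomeomorph X (Fin n → F))
    (φ : Schwartz (chartTarget e)) :
    ∃ K ⊆ e.source, IsCompact K ∧ ∀ x ∉ K, extendChart e φ x = 0 := by
  refine ⟨(fun u : chartTarget e => e.symm u.1) '' tsupport φ.1, ?_, ?_, fun x hxK => ?_⟩
  · rintro _ ⟨u, -, rfl⟩
    exact e.map_target u.2
  · exact φ.2.2.isCompact.image e.continuousOn_symm.domRestrict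
  · unfold extendChart
    split_ifs with hx
    · by_contra h0
      exact hxK ⟨⟨e x, e.map_source hx⟩, subset_tsupport _ h0, e.left_inv hx⟩
    · rfl

theorem isLocallyConstant_extendChart [T2Space X] (e : OpenPartialHomeomorph X (Fin n → F))
    (φ : Schwartz (chartTarget e)) : IsLocallyConstant (extendChart e φ) := by
  obtain ⟨K, hKe, hK, hzero⟩ := exists_isCompact_extendChart e φ
  rw [IsLocallyConstant.iff_eventually_eq]
  intro x
  by_cases hx : x ∈ e.source
  · have h1 := (IsLocallyConstant.iff_eventually_eq φ.1).1 φ.2.1 ⟨e x, e.map_source hx⟩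
    replace h1 := Filter.eventually_comap.1
      ((nhds_induced (Subtype.val : chartTarget e → (Fin n → F)) _) ▸ h1)
    filter_upwards [(e.continuousAt hx).eventually h1, e.open_source.mem_nhds hx] with y hy hys
    simpa [extendChart, hx, hys] using hy ⟨e y, e.map_source hys⟩ rfl
  · have hxK : x ∉ K := fun h => hx (hKe h)
    filter_upwards [hK.isClosed.isOpen_compl.mem_nhds hxK] with y hy
    rw [hzero y hy, hzero x hxK]

end Extend

section Smooth

variable {F : Type*} [NontriviallyNormedField F] [IsUltrametricDist F] [LocallyCompactSpace F]
  {m n : ℕ} {G : Type*} [TopologicalSpace G] [Group G] [ChartedSpace (Fin m → F) G]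
  {X : Type u} [TopologicalSpace X] [T2Space X] [ChartedSpace (Fin n → F) X]
  [IsManifold 𝓘(F, Fin n → F) ω X]
  {E : LocallyConstantSheaf.{u, w} X} {e : OpenPartialHomeomorph X (Fin n → F)}

theorem testSection_modulate_apply {κ : AddChar F Circle} (hκ : Continuous κ)
    (he : e ∈ IsManifold.maximalAtlas 𝓘(F, Fin n → F) ω X)
    {ℓ : ∀ x, Module.Dual ℂ (E.Stalk x)} (hℓ : E.IsDualSectionOn ℓ e.source)
    (φ : Schwartz (chartTarget e)) (w : (Fin n → F) →L[F] F) (x : X) :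
    (testSection E he hℓ (modulate hκ φ w)).1 x =
      (extendChart e φ x * ((κ (w (e x)) : Circle) : ℂ)) • (ℓ x).smulRight (chartDensity e x) := by
  by_cases hx : x ∈ e.source <;> simp [testSection, modulate, extendChart, hx]

/-- An invariant generalized section is smooth in every covector that does not vanish on the tangent
directions of the orbit. A test function oscillating in such a direction can be averaged
over finitely many elements of a small piece of a curve in `G`. The translations leave the amplitude,
the density and the section of `E^*` unchanged, and they change the phase through an isometry of
a ball, up to scaling, so that the average vanishes. -/
theorem isSmoothAt_coordDistribution [LieGroup 𝓘(F, Fin m → F) ω G] [MulAction G X]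
    [ContMDiffSMul 𝓘(F, Fin m → F) 𝓘(F, Fin n → F) ω G X]
    {κ : AddChar F Circle} (hκ : Continuous κ) (hκ_nontrivial : κ ≠ 1) (τ : E.Equivariant G)
    {ξ : GeneralizedSection F n E} (hξ : IsInvariant (m := m) τ ξ)
    (he : e ∈ IsManifold.maximalAtlas 𝓘(F, Fin n → F) ω X) {x₀ : X} (hx₀ : x₀ ∈ e.source)
    {ℓ : ∀ x, Module.Dual ℂ (E.Stalk x)} (hℓ : E.IsDualSectionOn ℓ e.source)
    (v : (Fin n → F) →L[F] F) (α : GroupLieAlgebra 𝓘(F, Fin m → F) G)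
    (hα : v (mfderiv 𝓘(F, Fin n → F) 𝓘(F, Fin n → F) e x₀ (infinitesimalAction F n m α x₀)) ≠ 0) :
    IsSmoothAt hκ (coordDistribution ξ he hℓ) ⟨e x₀, e.map_source hx₀⟩ v := by
  have : IsTopologicalGroup G := topologicalGroup_of_lieGroup 𝓘(F, Fin m → F) ω
  have : ContinuousSMul G X := ⟨(ContMDiffSMul.contMDiff_smul (I := 𝓘(F, Fin m → F))
    (I' := 𝓘(F, Fin n → F)) (n := ω) (G := G) (M := X)).continuous⟩
  obtain ⟨c, hc0, hc, hcα⟩ := exists_curve_of_groupLieAlgebra α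
  have hcc : Filter.Tendsto c (𝓝 0) (𝓝 1) := by simpa [ContinuousAt, hc0] using hc.continuousAt
  rw [← fderiv_chartFlow hc0 hc he hx₀ hcα] at hα
  set η : F := v (fderiv F (chartFlow c e) (0, e x₀) (1, 0)) with hη
  obtain ⟨ε, hε, hphase⟩ := exists_norm_sub_eq_of_hasStrictFDerivAt
    (contDiffAt_chartFlow hc0 hc he hx₀).analyticAt.hasStrictFDerivAt v hα
  have hcp : Filter.Tendsto (fun p : F × X => (c p.1, p.2)) (𝓝 (0, x₀)) (𝓝 (1, x₀)) := by
    rw [nhds_prod_eq, nhds_prod_eq]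
    exact hcc.prodMap Filter.tendsto_id
  have hlocal := (eventually_pullback_chartDensity hc0 hc he hx₀).and
    (hcp.eventually (τ.eventually_dual_comp_act hx₀ hℓ))
  rw [nhds_prod_eq, Filter.eventually_prod_iff] at hlocal
  obtain ⟨pF, hpF, pX, hpX, hlocal⟩ := hlocal
  have hA : ∀ᶠ u in 𝓝 (⟨e x₀, e.map_source hx₀⟩ : chartTarget e),
      pX (e.symm u.1) ∧ u.1 ∈ Metric.ball (e x₀) ε := by
    have h1 : Filter.Tendsto (fun u : chartTarget e => e.symm u.1)
        (𝓝 ⟨e x₀, e.map_source hx₀⟩) (𝓝 x₀) := by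
      have h2 := e.continuousAt_symm (e.map_source hx₀)
      rw [ContinuousAt, e.left_inv hx₀] at h2
      exact h2.comp (continuous_subtype_val.tendsto
        (⟨e x₀, e.map_source hx₀⟩ : chartTarget e))
    exact (h1.eventually hpX).and
      (continuous_subtype_val.continuousAt.eventually (Metric.ball_mem_nhds _ hε))
  obtain ⟨A, hA, hAo, hxA⟩ := eventually_nhds_iff.1 hA
  refine ⟨A, hAo, hxA, Metric.ball v ε, Metric.isOpen_ball, Metric.mem_ball_self hε,
    fun φ hφ => ?_⟩
  obtain ⟨K, -, hK, hzero⟩ := exists_isCompact_extendChart e φ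
  have hsmall := ((hcc.eventually (eventually_forall_smul_eq (G := G)
    (isLocallyConstant_extendChart e φ) hK hzero)).and hpF).and
    (Metric.eventually_nhds_iff.2 ⟨ε, hε, fun _ h => h⟩)
  obtain ⟨r, hr, hsmall⟩ := Metric.nhds_basis_closedBall.eventually_iff.1 hsmall
  simp only [mem_closedBall_zero_iff, dist_zero_right] at hsmall
  obtain ⟨s₁, hs₁⟩ : ∃ s, κ s ≠ 1 := by
    by_contra! h
    exact hκ_nontrivial (by ext s; simp [h s])
  have hη0 : 0 < ‖η‖ := norm_pos_iff.2 hα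
  -- Beyond this bound, the character `κ (lam * η * ·)` is nontrivial on the ball of radius `r`.
  refine ⟨‖s₁‖ / (‖η‖ * r) + 1, by positivity, fun lam hlam w hw => ?_⟩
  have hlam0 : 0 < ‖lam‖ := lt_trans (by positivity) hlam
  have hμ : ∃ s : F, ‖s‖ ≤ r ∧ κ (lam * η * s) ≠ 1 := by
    refine ⟨s₁ / (lam * η), ?_, ?_⟩
    · have h1 : ‖s₁‖ / (‖η‖ * r) < ‖lam‖ := by linarith
      rw [div_lt_iff₀ (by positivity)] at h1
      rw [norm_div, norm_mul, div_le_iff₀ (by positivity)]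
      linarith
    · rwa [mul_div_cancel₀ _ (mul_ne_zero (norm_pos_iff.1 hlam0) hα)]
  obtain ⟨T, hT, hTr, hsum⟩ := exists_finset_sum_addChar_eq_zero hκ hr hμ
  set f := testSection E he hℓ (modulate hκ φ (lam • w)) with hf
  -- Each translate equals the test section with only its phase replaced.
  have hfz : ∑ t ∈ T, translate F n m τ (c t) f = 0 := by
    apply Subtype.ext
    funext x
    rw [AddSubmonoidClass.coe_finsetSum, Finset.sum_apply]
    have hterm : ∀ t, (translate F n m τ (c t) f).1 x = (Density.pullback
        (mfderiv 𝓘(F, Fin n → F) 𝓘(F, Fin n → F) (fun y : X => c t • y) x)).comp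
          ((f.1 (c t • x)).comp (τ.act (c t) x)) := fun t => rfl
    by_cases hφx : extendChart e φ x = 0
    · refine Finset.sum_eq_zero fun t ht => ?_
      rw [hterm, hf, testSection_modulate_apply, (hsmall (hTr t ht)).1.1, hφx]
      simp
    · have hx : x ∈ e.source := by
        by_contra h
        simp [extendChart, h] at hφx
      have hxA := hA _ (hφ (show φ.1 ⟨e x, e.map_source hx⟩ ≠ 0 by
        simpa [extendChart, hx] using hφx))
      simp only [e.left_inv hx] at hxA
      have hterm' : ∀ t ∈ T, (translate F n m τ (c t) f).1 x =
          (extendChart e φ x * ((κ (lam * η * (w (chartFlow c e (t, e x)) / η)) : Circle) : ℂ)) •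
            (ℓ x).smulRight (chartDensity e x) := by
        intro t ht
        obtain ⟨h1, h2⟩ := hlocal (hsmall (hTr t ht)).1.2 hxA.1
        have h3 : lam * η * (w (chartFlow c e (t, e x)) / η) = (lam • w) (e (c t • x)) := by
          simp only [chartFlow, e.left_inv hx, _root_.smul_apply, smul_eq_mul]
          field_simp
        rw [hterm, hf, testSection_modulate_apply, (hsmall (hTr t ht)).1.1, h3, ← h1, ← h2]
        ext a : 1
        simp
      rw [Finset.sum_congr rfl hterm', ← Finset.sum_smul, ← Finset.mul_sum,
        hsum (fun t => w (chartFlow c e (t, e x)) / η), mul_zero, zero_smul]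
      · rfl
      · intro s t hs ht
        rw [← sub_div, norm_div, hphase w hw (e x) hxA.2 s t (hsmall hs).2 (hsmall ht).2,
          mul_div_cancel_left₀ _ hη0.ne']
  have hcard : (T.card : ℂ) * ξ f = 0 := by
    have h1 := congrArg ξ hfz
    rw [map_sum, map_zero, Finset.sum_congr rfl fun t _ => hξ (c t) f] at h1
    simpa using h1
  exact (mul_eq_zero.1 hcard).resolve_left (by simpa using hT.ne_empty)

end Smooth

end WaveFront

theorem mainTheorem2
    {F : Type*} [NontriviallyNormedField F] [IsUltrametricDist F] [LocallyCompactSpace F]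
    [CharZero F]
    {κ : AddChar F Circle} (hκ : Continuous κ) (hκ_nontrivial : κ ≠ 1)
    {m n : ℕ}
    {G : Type*} [TopologicalSpace G] [Group G] [ChartedSpace (Fin m → F) G]
    [LieGroup 𝓘(F, Fin m → F) ω G]
    {X : Type*} [TopologicalSpace X] [T2Space X] [ChartedSpace (Fin n → F) X]
    [IsManifold 𝓘(F, Fin n → F) ω X]
    [MulAction G X] [ContMDiffSMul 𝓘(F, Fin m → F) 𝓘(F, Fin n → F) ω G X]
    (E : WaveFront.LocallyConstantSheaf X) (τ : E.Equivariant G)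
    (ξ : WaveFront.GeneralizedSection F n E) (hξ : WaveFront.IsInvariant (m := m) τ ξ) :
    WaveFront.waveFrontSet hκ ξ ⊆
      {p : WaveFront.Cotangent F n X | ∀ α : GroupLieAlgebra 𝓘(F, Fin m → F) G,
        p.2 (WaveFront.infinitesimalAction F n m α p.1) = 0} := by
  rintro ⟨x, p⟩ ⟨e, he, hx, ℓ, hℓ, v, hv, hp⟩ α
  by_contra hα
  refine hv (WaveFront.isSmoothAt_coordDistribution hκ hκ_nontrivial τ hξ he hx hℓ v α ?_)
  rwa [hp] at hα
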